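/- For a finite simple graph $G$, let $\omega(G)$ be the maximum number of vertices in a clique of $G$, and let $\mathrm{lpt}(G)$ be the minimum cardinality of a set of vertices of $G$ that contains at least one vertex of every longest path of $G$ (a longest path is a path with the maximum number of edges among all paths of $G$). A graph is chordal if each of its induced cycles has length three. Theorem. For every finite connected chordal graph $G$, $$\mathrm{lpt}(G)\le \max\{1,\ \omega(G)-2\}.$$ -/

import Mathlib

namespace SimpleGraph

variable {V : Type*}

/-- A graph is chordal if every induced cycle has length three. A cycle is induced exactly
when it has no chord. -/
def IsChordal (G : SimpleGraph V) : Prop :=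
  ∀ ⦃v : V⦄ (c : G.Walk v v), c.IsCycle → c.IsChordless → c.length = 3

/-- A longest path of `G`: a path whose number of edges is maximum among all paths of `G`. -/
def Walk.IsLongestPath {G : SimpleGraph V} {u v : V} (p : G.Walk u v) : Prop :=
  p.IsPath ∧ ∀ ⦃x y : V⦄ (q : G.Walk x y), q.IsPath → q.length ≤ p.length

/-- A longest path transversal: a set of vertices that meets every longest path of `G`. -/
def IsLongestPathTransversal (G : SimpleGraph V) (S : Finset V) : Prop :=
  ∀ ⦃u v : V⦄ (p : G.Walk u v), p.IsLongestPath → ∃ w ∈ S, w ∈ p.support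

/-- `lpt(G)`: the minimum cardinality of a longest path transversal of the finite graph `G`. -/
noncomputable def lpt (G : SimpleGraph V) : ℕ :=
  sInf {k | ∃ S : Finset V, G.IsLongestPathTransversal S ∧ S.card = k}

/-- In a finite graph the minimum that defines `lpt` is attained. -/
theorem exists_isLongestPathTransversal_card_eq_lpt [Finite V] (G : SimpleGraph V) :
    ∃ S : Finset V, G.IsLongestPathTransversal S ∧ S.card = G.lpt := by
  have := Fintype.ofFinite V
  have hne : {k | ∃ S : Finset V, G.IsLongestPathTransversal S ∧ S.card = k}.Nonempty :=
    ⟨_, Finset.univ, fun u _ p _ => ⟨u, Finset.mem_univ u, p.start_mem_support⟩, rfl⟩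
  exact Nat.sInf_mem hne

end SimpleGraph

/-! Suppose that every set of at most max {1, ω - 2} vertices is missed by some longest path, and
let L be the length of a longest path. The basic tool is an exchange (`false_of_cross`): cut two
longest paths at adjacent vertices u and v. If each arm at u is disjoint from the arm at v it is
paired with, joining the pairs by the edge uv gives two paths of total length 2L + 2.

Let K be a maximal clique. For any two of its vertices, some longest path meets K in at most these
two. By chordality, each component of G - K has no edge to some vertex of K
(`IsMaxClique.exists_not_adj_compOf`). Exchanges then give a longest path with at most one vertex in
K (`exists_pathOn_inter_subsingleton`), and next a "fenced" one, which apart from such a vertex lies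
in one component of G - K (`exists_fenced_pathOn`).

Choose K and a fenced path so that its component C is smallest. Let S be the set of vertices of K
with a neighbour in C. Some c in C is adjacent to all of S; extend S ∪ {c} to a maximal clique K'.
By minimality, the path fenced for K' avoids C. Longest paths intersect pairwise, so both fenced
paths pass through one v in S, on different sides of S. As |S| ≤ ω - 1, some longest path misses v
and meets S at most once, and a last exchange refutes this (`false_of_two_sides`). -/

namespace SimpleGraph

variable {V : Type*} {G : SimpleGraph V}

/-! ### Paths recorded by ends, vertex set and length -/

/-- There is a path from `u` to `v` with vertex set `s` and with `n` edges. -/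
def PathOn (G : SimpleGraph V) (u v : V) (s : Set V) (n : ℕ) : Prop :=
  ∃ p : G.Walk u v, p.IsPath ∧ (∀ w, w ∈ s ↔ w ∈ p.support) ∧ p.length = n

namespace PathOn

variable {u v w x y : V} {s t : Set V} {n m : ℕ}

theorem start_mem (h : G.PathOn u v s n) : u ∈ s := by
  obtain ⟨p, -, hs, -⟩ := h
  simp [hs]

theorem end_mem (h : G.PathOn u v s n) : v ∈ s := by
  obtain ⟨p, -, hs, -⟩ := h
  simp [hs]

theorem symm (h : G.PathOn u v s n) : G.PathOn v u s n := by
  obtain ⟨p, hp, hs, hn⟩ := h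
  exact ⟨p.reverse, hp.reverse, by simpa using hs, by simpa using hn⟩

theorem trans (h : G.PathOn u v s n) (h' : G.PathOn v w t m) (hd : ∀ x ∈ s, x ∈ t → x = v) :
    G.PathOn u w (s ∪ t) (n + m) := by
  obtain ⟨p, hp, hs, rfl⟩ := h
  obtain ⟨q, hq, ht, rfl⟩ := h'
  refine ⟨p.append q, ?_, fun x => by simp [hs, ht], by simp⟩
  have hq' := hq.support_nodup
  rw [Walk.isPath_def, Walk.support_append, List.nodup_append']
  rw [← Walk.cons_tail_support, List.nodup_cons] at hq'
  refine ⟨hp.support_nodup, hq'.2, fun x hx hx' => hq'.1 ?_⟩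
  have := hd x ((hs x).2 hx) ((ht x).2 (List.mem_of_mem_tail hx'))
  exact this ▸ hx'

theorem of_adj (h : G.Adj u v) : G.PathOn u v {u, v} 1 :=
  ⟨h.toWalk, Walk.IsPath.of_adj h, by simp, by simp⟩

theorem trans_adj (h : G.PathOn u v s n) (hadj : G.Adj v x) (h' : G.PathOn x y t m)
    (hd : ∀ w ∈ s, w ∉ t) : G.PathOn u y (s ∪ t) (n + 1 + m) := by
  have hx := h'.start_mem
  have hv := h.end_mem
  have h1 := h.trans (of_adj hadj) (by
    rintro z hz (rfl | rfl)
    exacts [rfl, absurd hx (hd _ hz)])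
  have h2 := h1.trans h' (by
    rintro z (hz | rfl | rfl) hz'
    exacts [absurd hz' (hd _ hz), absurd hz' (hd _ hv), rfl])
  convert h2 using 1
  ext z
  simp only [Set.mem_union, Set.mem_insert_iff, Set.mem_singleton_iff]
  constructor
  · tauto
  · rintro ((h | rfl | rfl) | h) <;> tauto

theorem split (h : G.PathOn u v s n) (hw : w ∈ s) :
    ∃ s₁ s₂ n₁ n₂, G.PathOn u w s₁ n₁ ∧ G.PathOn w v s₂ n₂ ∧ n₁ + n₂ = n ∧
      (∀ x, x ∈ s ↔ x ∈ s₁ ∨ x ∈ s₂) ∧ ∀ x ∈ s₁, x ∈ s₂ → x = w := by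
  classical
  obtain ⟨p, hp, hs, rfl⟩ := h
  have hw' := (hs w).1 hw
  refine ⟨{x | x ∈ (p.takeUntil w hw').support}, {x | x ∈ (p.dropUntil w hw').support},
    (p.takeUntil w hw').length, (p.dropUntil w hw').length,
    ⟨_, hp.takeUntil hw', by simp, rfl⟩, ⟨_, hp.dropUntil hw', by simp, rfl⟩, ?_, ?_, ?_⟩
  · rw [← Walk.length_append, Walk.take_spec]
  · intro x
    rw [hs x]
    conv_lhs => rw [← p.take_spec hw', Walk.mem_support_append_iff]
    rfl
  · intro x hx hx'
    by_contra hne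
    rw [← p.take_spec hw', Walk.isPath_def, Walk.support_append, List.nodup_append'] at hp
    refine hp.2.2 hx ?_
    have hx'' : x ∈ (p.dropUntil w hw').support := hx'
    rw [← Walk.cons_tail_support, List.mem_cons] at hx''
    exact hx''.resolve_left hne

theorem eq_of_length_zero (h : G.PathOn u v s 0) : u = v := by
  obtain ⟨p, -, -, hn⟩ := h
  exact Walk.eq_of_length_eq_zero hn

theorem ncard_eq (h : G.PathOn u v s n) : s.ncard = n + 1 := by
  classical
  obtain ⟨p, hp, hs, rfl⟩ := h
  have : s = (p.support.toFinset : Set V) := by ext; simp [hs]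
  rw [this, Set.ncard_coe_finset, List.toFinset_card_of_nodup hp.support_nodup,
    Walk.length_support]

theorem of_walk (p : G.Walk u v) :
    ∃ s n, G.PathOn u v s n ∧ n ≤ p.length ∧ ∀ x ∈ s, x ∈ p.support := by
  classical
  exact ⟨{x | x ∈ p.bypass.support}, _, ⟨p.bypass, p.bypass_isPath, by simp, rfl⟩,
    p.length_bypass_le_length, fun x hx => p.support_bypass_subset_support hx⟩

/-- A path through `a` and `b` consists of a part before, between and after these vertices. -/
theorem split_three {a b : V} (h : G.PathOn u v s n) (ha : a ∈ s) (hb : b ∈ s) :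
    ∃ (e f : V) (H M T : Set V) (i j k : ℕ), G.PathOn a e H i ∧ G.PathOn a b M j ∧
      G.PathOn b f T k ∧ i + j + k = n ∧ (∀ x ∈ s, x ∈ H ∨ x ∈ M ∨ x ∈ T) ∧
      (∀ x, x ∈ H ∨ x ∈ M ∨ x ∈ T → x ∈ s) ∧
      (∀ x ∈ H, x ∈ M → x = a) ∧ (∀ x ∈ M, x ∈ T → x = b) ∧ (∀ x ∈ H, x ∈ T → x = a ∧ x = b) := by
  obtain ⟨s₁, s₂, n₁, n₂, h₁, h₂, hn, hs, hd⟩ := h.split ha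
  rcases (hs b).1 hb with hb | hb
  · obtain ⟨t₁, t₂, m₁, m₂, k₁, k₂, hm, ht, he⟩ := h₁.split hb
    refine ⟨v, u, s₂, t₂, t₁, n₂, m₂, m₁, h₂, k₂.symm, k₁.symm, by omega, ?_, ?_, ?_, ?_, ?_⟩
    all_goals grind [k₂.end_mem]
  · obtain ⟨t₁, t₂, m₁, m₂, k₁, k₂, hm, ht, he⟩ := h₂.split hb
    refine ⟨u, v, s₁, t₁, t₂, n₁, m₁, m₂, h₁.symm, k₁, k₂, by omega, ?_, ?_, ?_, ?_, ?_⟩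
    all_goals grind [k₁.start_mem]

end PathOn

/-! ### Paths and the components left by deleting a set -/

/-- `X` is a union of connected components of the graph that remains when `K` is deleted. -/
structure IsSide (G : SimpleGraph V) (K X : Set V) : Prop where
  notMem : ∀ x ∈ X, x ∉ K
  mem_of_adj : ∀ x ∈ X, ∀ y, G.Adj x y → y ∉ K → y ∈ X

/-- The component of `x` in the graph that remains when `K` is deleted. -/
def compOf (G : SimpleGraph V) (K : Set V) (x : V) : Set V :=
  {y | ∃ p : G.Walk x y, ∀ w ∈ p.support, w ∉ K}

section Sides

variable {K X : Set V} {x y u e : V} {s : Set V} {n : ℕ}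

theorem mem_compOf_self (hx : x ∉ K) : x ∈ G.compOf K x := ⟨.nil, by simpa⟩

theorem isSide_compOf : G.IsSide K (G.compOf K x) where
  notMem := fun y ⟨p, hp⟩ => hp y p.end_mem_support
  mem_of_adj := fun y ⟨p, hp⟩ z h hz => ⟨p.concat h, by
    intro w hw
    rw [Walk.support_concat, List.mem_append, List.mem_singleton] at hw
    rcases hw with hw | rfl
    exacts [hp w hw, hz]⟩

theorem IsSide.mem_iff_of_walk (hX : G.IsSide K X) (p : G.Walk x y) (hp : ∀ w ∈ p.support, w ∉ K) :
    x ∈ X ↔ y ∈ X := by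
  induction p with
  | nil => rfl
  | cons h p ih =>
    rw [← ih fun w hw => hp w (by simp [hw])]
    exact ⟨fun hx => hX.mem_of_adj _ hx _ h (hp _ (by simp)),
      fun hx => hX.mem_of_adj _ hx _ h.symm (hp _ (by simp))⟩

theorem IsSide.compOf_subset (hX : G.IsSide K X) (hx : x ∈ X) : G.compOf K x ⊆ X :=
  fun _ ⟨p, hp⟩ => (hX.mem_iff_of_walk p hp).1 hx

theorem IsSide.notMem_of_mem_compOf (hX : G.IsSide K X) (hx : x ∉ X) (hy : y ∈ G.compOf K x) :
    y ∉ X := by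
  obtain ⟨p, hp⟩ := hy
  exact fun h => hx ((hX.mem_iff_of_walk p hp).2 h)

theorem mem_compOf_of_mem_of_mem {z : V} (hx : x ∈ G.compOf K z) (hy : y ∈ G.compOf K z) :
    y ∈ G.compOf K x := by
  obtain ⟨p, hp⟩ := hx
  obtain ⟨q, hq⟩ := hy
  refine ⟨p.reverse.append q, fun w hw => ?_⟩
  rw [Walk.mem_support_append_iff, Walk.support_reverse, List.mem_reverse] at hw
  exact hw.elim (hp w) (hq w)

theorem IsSide.walk_dichotomy (hX : G.IsSide K X) (p : G.Walk x y) (hp : p.IsPath)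
    (hK : ∀ w ∈ p.support, w ∈ K → w = y) (hx : x ∉ K) :
    (x ∈ X → ∀ w ∈ p.support, w ∈ K ∨ w ∈ X) ∧ (x ∉ X → ∀ w ∈ p.support, w ∉ X) := by
  induction p with
  | nil => simp +contextual
  | @cons x z y h p ih =>
    rw [Walk.cons_isPath_iff] at hp
    by_cases hz : z ∈ K
    · obtain rfl := hK z (by simp) hz
      obtain rfl := (Walk.isPath_iff_nil.1 hp.1).eq_nil
      have := fun h => hX.notMem z h hz
      simp; grind
    · have ih := ih hp.1 (fun w hw => hK w (by simp [hw])) hz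
      have h1 := fun hx => hX.mem_of_adj x hx z h hz
      have h2 := fun hz => hX.mem_of_adj z hz x h.symm hx
      simp; grind

/-- Between its ends the path avoids `K`, so it cannot change sides there. -/
theorem IsSide.dichotomy (hX : G.IsSide K X) (h : G.PathOn u e s n)
    (hK : ∀ w ∈ s, w ∈ K → w = u ∨ w = e) :
    (∀ w ∈ s, w ∈ K ∨ w ∈ X) ∨ ∀ w ∈ s, w ∉ X := by
  obtain ⟨p, hp, hs, -⟩ := h
  simp only [hs] at hK ⊢
  by_cases hu : u ∈ K
  · cases p with
    | nil => simp [hu]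
    | @cons _ z _ h p =>
      rw [Walk.cons_isPath_iff] at hp
      have huX := fun h => hX.notMem u h hu
      have hK' : ∀ w ∈ p.support, w ∈ K → w = e := by
        intro w hw hwK
        refine (hK w (by simp [hw]) hwK).resolve_left ?_
        rintro rfl
        exact hp.2 hw
      by_cases hz : z ∈ K
      · obtain rfl := hK' z (by simp) hz
        obtain rfl := (Walk.isPath_iff_nil.1 hp.1).eq_nil
        simp [hu, hz]
      · have := hX.walk_dichotomy p hp.1 hK' hz
        simp; grind
  · have := hX.walk_dichotomy p hp (by
      intro w hw hwK
      refine (hK w hw hwK).resolve_left ?_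
      rintro rfl
      exact hu hwK) hu
    grind

/-- A path that starts in a vertex of `K` without neighbours in `X` and that can meet `K` only in
its ends does not meet `X`. -/
theorem IsSide.notMem_of_not_adj (hX : G.IsSide K X) (h : G.PathOn u e s n)
    (hK : ∀ w ∈ s, w ∈ K → w = u ∨ w = e) (hu : u ∈ K) (hadj : ∀ x ∈ X, ¬ G.Adj u x) :
    ∀ w ∈ s, w ∉ X := by
  obtain ⟨p, hp, hs, -⟩ := h
  simp only [hs] at hK ⊢
  have huX : u ∉ X := fun h => hX.notMem u h hu
  cases p with
  | nil => simpa using huX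
  | @cons _ z _ h p =>
    rw [Walk.cons_isPath_iff] at hp
    have hK' : ∀ w ∈ p.support, w ∈ K → w = e := by
      intro w hw hwK
      refine (hK w (by simp [hw]) hwK).resolve_left ?_
      rintro rfl
      exact hp.2 hw
    have hzX : z ∉ X := fun hz => hadj z hz h
    by_cases hz : z ∈ K
    · obtain rfl := hK' z (by simp) hz
      obtain rfl := (Walk.isPath_iff_nil.1 hp.1).eq_nil
      simp [huX, hzX]
    · have := hX.walk_dichotomy p hp.1 hK' hz
      simp; grind

end Sides

theorem exists_mem_ne_ne {K : Set V} {a b c : V} (ha : a ∈ K) (hb : b ∈ K) (hc : c ∈ K)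
    (hab : a ≠ b) (hac : a ≠ c) (hbc : b ≠ c) (x y : V) : ∃ z ∈ K, z ≠ x ∧ z ≠ y := by
  by_contra! h
  have h' : ∀ z ∈ K, z = x ∨ z = y := fun z hz => or_iff_not_imp_left.2 (h z hz)
  have := h' a ha
  have := h' b hb
  have := h' c hc
  grind

/-! ### A longest path with at most one vertex in the clique -/

section Recombination

variable {K : Set V} {L : ℕ}

/-- A path of length `L` that meets `K` exactly in `a` and `b`, cut at these two vertices. -/
structure IsCutPath (G : SimpleGraph V) (K : Set V) (L : ℕ) (a b : V) (H M T : Set V)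
    (i j k : ℕ) : Prop where
  head : ∃ e, G.PathOn a e H i
  middle : G.PathOn a b M j
  tail : ∃ f, G.PathOn b f T k
  length : i + j + k = L
  head_middle : ∀ x ∈ H, x ∈ M → x = a
  middle_tail : ∀ x ∈ M, x ∈ T → x = b
  head_tail : ∀ x ∈ H, x ∉ T
  mem : ∀ x, x ∈ H ∨ x ∈ M ∨ x ∈ T → x ∈ K → x = a ∨ x = b
  ne : a ≠ b

namespace IsCutPath

variable {a b : V} {H M T : Set V} {i j k : ℕ}

theorem eq_of_mem_head (h : G.IsCutPath K L a b H M T i j k) {x : V} (hx : x ∈ H) (hK : x ∈ K) :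
    x = a := by
  obtain ⟨f, hf⟩ := h.tail
  have := hf.start_mem
  have := h.mem x
  have := h.head_tail x
  grind

theorem eq_of_mem_tail (h : G.IsCutPath K L a b H M T i j k) {x : V} (hx : x ∈ T) (hK : x ∈ K) :
    x = b := by
  obtain ⟨f, hf⟩ := h.head
  have := hf.start_mem
  have := h.mem x
  have := h.head_tail x
  grind

end IsCutPath

theorem PathOn.exists_isCutPath {u v a b : V} {s : Set V} (h : G.PathOn u v s L) (ha : a ∈ s)
    (hb : b ∈ s) (hab : a ≠ b) (hs : ∀ x ∈ s, x ∈ K → x = a ∨ x = b) :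
    ∃ H M T i j k, G.IsCutPath K L a b H M T i j k := by
  obtain ⟨e, f, H, M, T, i, j, k, h1, h2, h3, h4, h5, h6, h7, h8, h9⟩ := h.split_three ha hb
  exact ⟨H, M, T, i, j, k, ⟨e, h1⟩, h2, ⟨f, h3⟩, h4, h7, h8,
    fun x hx hx' => hab ((h9 x hx hx').1.symm.trans (h9 x hx hx').2),
    fun x hx => hs x (h6 x hx), hab⟩

variable (hmax : ∀ u v s n, G.PathOn u v s n → n ≤ L)
include hmax

/-- Two longest paths that are cut at the adjacent vertices `u` and `v` cannot be recombined. -/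
theorem false_of_cross {u v p₁ p₂ q₁ q₂ : V} {P₁ P₂ Q₁ Q₂ : Set V} {i₁ i₂ j₁ j₂ : ℕ}
    (hadj : G.Adj u v) (hP₁ : G.PathOn u p₁ P₁ i₁) (hP₂ : G.PathOn u p₂ P₂ i₂)
    (hQ₁ : G.PathOn v q₁ Q₁ j₁) (hQ₂ : G.PathOn v q₂ Q₂ j₂) (hi : i₁ + i₂ = L) (hj : j₁ + j₂ = L)
    (h₁ : ∀ x ∈ P₁, x ∉ Q₂) (h₂ : ∀ x ∈ P₂, x ∉ Q₁) : False := by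
  have := hmax _ _ _ _ (hP₁.symm.trans_adj hadj hQ₂ h₁)
  have := hmax _ _ _ _ (hP₂.symm.trans_adj hadj hQ₁ h₂)
  omega

/-- The middle part of a longest path can be replaced by a path that avoids the rest. -/
theorem IsCutPath.lt_of_detour {z a b : V} {H M T N : Set V} {i j k m : ℕ}
    (h : G.IsCutPath K L z a H M T i j k) (hN : G.PathOn a b N m) (hadj : G.Adj z b)
    (hH : ∀ x ∈ H, x ∉ N) (hT : ∀ x ∈ N, x ∈ T → x = a) : m < j := by
  obtain ⟨e, he⟩ := h.head
  obtain ⟨f, hf⟩ := h.tail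
  have := h.head_tail
  have := hmax _ _ _ _ ((he.symm.trans_adj hadj hN.symm hH).trans hf (by grind))
  have := h.length
  omega

/-- Otherwise the middle part is just the edge `ab`, and the detour `a`, `c`, `b` lengthens the
path. -/
theorem IsCutPath.exists_mem_middle {a b c : V} {H M T : Set V} {i j k : ℕ}
    (hK : G.IsClique K) (h : G.IsCutPath K L a b H M T i j k) (ha : a ∈ K) (hb : b ∈ K)
    (hc : c ∈ K) (hca : c ≠ a) (hcb : c ≠ b) : ∃ x ∈ M, x ∉ K := by
  by_contra! hM
  obtain ⟨e, he⟩ := h.head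
  obtain ⟨f, hf⟩ := h.tail
  have h1 : M ⊆ {a, b} := fun x hx => h.mem x (by simp [hx]) (hM x hx)
  have h2 := Set.ncard_le_ncard h1 (Set.toFinite _)
  rw [h.middle.ncard_eq, Set.ncard_pair h.ne] at h2
  have h3 := he.symm.trans (PathOn.of_adj (hK ha hc hca.symm)) (by
    have := h.mem c
    rintro x hx (rfl | rfl) <;> grind)
  have := hmax _ _ _ _ (h3.trans_adj (hK hc hb hcb) hf (by
    have := h.mem c
    have := h.head_tail
    have := hf.start_mem
    have := he.start_mem
    rintro x (hx | rfl | rfl) <;> grind))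
  have := h.length
  omega

/-- Among all longest paths cut at two vertices of `K`, take one with the longest middle part `M`,
from `a` to `b`. It runs through a component `X` to which some `z` in `K` has no edge. The paths cut
at `z, a` and at `z, b` must have their tails inside `X`, while their other parts avoid `X`; so they
can be exchanged along the edge `ab`. -/
theorem exists_pathOn_inter_subsingleton_of_three (hK : G.IsClique K)
    (hcomp : ∀ x ∉ K, ∃ z ∈ K, ∀ y ∈ G.compOf K x, ¬ G.Adj z y)
    (hpair : ∀ a ∈ K, ∀ b ∈ K, a ≠ b → ∃ u v s, G.PathOn u v s L ∧ ∀ w ∈ s, w ∈ K → w = a ∨ w = b)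
    {a₀ b₀ c₀ : V} (ha₀ : a₀ ∈ K) (hb₀ : b₀ ∈ K) (hc₀ : c₀ ∈ K) (hab₀ : a₀ ≠ b₀) (hac₀ : a₀ ≠ c₀)
    (hbc₀ : b₀ ≠ c₀) :
    ∃ v ∈ K, ∃ x y s, G.PathOn x y s L ∧ ∀ w ∈ s, w ∈ K → w = v := by
  by_contra! hcon
  -- Both `a` and `b` lie on the path, as it would otherwise meet `K` at most once.
  have hcut : ∀ a ∈ K, ∀ b ∈ K, a ≠ b → ∃ H M T i j k, G.IsCutPath K L a b H M T i j k := by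
    intro a ha b hb hab
    obtain ⟨u, v, s, hs, hsK⟩ := hpair a ha b hb hab
    refine hs.exists_isCutPath ?_ ?_ hab hsK
    · obtain ⟨w, hw, hwK, hne⟩ := hcon b hb u v s hs
      grind
    · obtain ⟨w, hw, hwK, hne⟩ := hcon a ha u v s hs
      grind
  obtain ⟨m, ⟨a, ha, b, hb, hab, H, M, T, i, k, h⟩, hm⟩ : ∃ m, (∃ a ∈ K, ∃ b ∈ K, a ≠ b ∧
      ∃ H M T i k, G.IsCutPath K L a b H M T i m k) ∧ ∀ m', (∃ a ∈ K, ∃ b ∈ K, a ≠ b ∧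
      ∃ H M T i k, G.IsCutPath K L a b H M T i m' k) → m' ≤ m := by
    have hbdd : ∀ m', (∃ a ∈ K, ∃ b ∈ K, a ≠ b ∧
      ∃ H M T i k, G.IsCutPath K L a b H M T i m' k) → m' ≤ L := by
      rintro m' ⟨a, ha, b, hb, hab, H, M, T, i, k, h⟩
      have := h.length
      omega
    obtain ⟨H, M, T, i, j, k, h⟩ := hcut a₀ ha₀ b₀ hb₀ hab₀
    have hne : ∃ m', ∃ a ∈ K, ∃ b ∈ K, a ≠ b ∧
      ∃ H M T i k, G.IsCutPath K L a b H M T i m' k := ⟨j, a₀, ha₀, b₀, hb₀, hab₀, H, M, T, i, k, h⟩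
    exact ⟨_, Nat.sSup_mem hne ⟨L, hbdd⟩, fun m' hm' => le_csSup ⟨L, hbdd⟩ hm'⟩
  obtain ⟨x, hxM, hxK⟩ : ∃ x ∈ M, x ∉ K := by
    obtain ⟨c, hc, hca, hcb⟩ := exists_mem_ne_ne ha₀ hb₀ hc₀ hab₀ hac₀ hbc₀ a b
    exact h.exists_mem_middle hmax hK ha hb hc hca hcb
  obtain ⟨z, hz, hzX⟩ := hcomp x hxK
  set X := G.compOf K x with hXdef
  have hX : G.IsSide K X := isSide_compOf
  have hxX : x ∈ X := mem_compOf_self hxK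
  have hMX : ∀ w ∈ M, w ∈ K ∨ w ∈ X :=
    (hX.dichotomy h.middle fun w hw => h.mem w (by simp [hw])).resolve_right
      fun h' => h' x hxM hxX
  have hza : z ≠ a := by
    rintro rfl
    exact hX.notMem_of_not_adj h.middle (fun w hw => h.mem w (by simp [hw])) hz hzX x hxM hxX
  have hzb : z ≠ b := by
    rintro rfl
    exact hX.notMem_of_not_adj h.middle.symm (fun w hw hwK => (h.mem w (by simp [hw]) hwK).symm)
      hz hzX x hxM hxX
  -- Stated for arbitrary `a` and `b` so that it applies to `M` in both directions.
  have key : ∀ a ∈ K, ∀ b ∈ K, z ≠ a → z ≠ b → G.PathOn a b M m →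
      (∀ w ∈ M, w ∈ K → w = a ∨ w = b) → ∃ e f P T i k, G.PathOn a e P i ∧ G.PathOn a f T k ∧
      i + k = L ∧ (∀ w ∈ P, w ∉ X) ∧ (∀ w ∈ P, w ∈ K → w = z ∨ w = a) ∧
      ∀ w ∈ T, w = a ∨ w ∈ X := by
    clear h hMX hab ha hb hza hzb H T i k
    intro a ha b hb hza hzb hM hMK
    have hMX : ∀ w ∈ M, w ∈ K ∨ w ∈ X :=
      (hX.dichotomy hM hMK).resolve_right fun h' => h' x hxM hxX
    obtain ⟨H', M', T', i', j', k', h'⟩ := hcut z hz a ha hza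
    obtain ⟨e, he⟩ := h'.head
    obtain ⟨f, hf⟩ := h'.tail
    have hHX := hX.notMem_of_not_adj he (fun w hw hwK => .inl (h'.eq_of_mem_head hw hwK)) hz hzX
    have hMX' := hX.notMem_of_not_adj h'.middle (fun w hw => h'.mem w (by simp [hw])) hz hzX
    have hTX : ∀ w ∈ T', w ∈ K ∨ w ∈ X := by
      refine (hX.dichotomy hf fun w hw hwK => .inl (h'.eq_of_mem_tail hw hwK)).resolve_right ?_
      intro hTX
      -- If the tail avoided `X`, the edge `zb` followed by `M` could replace `M'`; so `M'` would be
      -- longer than `M`, against the choice of `M`.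
      have h1 := h'.lt_of_detour hmax hM (hK hz hb hzb) (fun w hw hwM => by
        rcases hMX w hwM with hwK | hwX
        · have := h'.eq_of_mem_head hw hwK
          have := hMK w hwM hwK
          grind
        · exact hHX w hw hwX) (fun w hwM hw => by
        rcases hMX w hwM with hwK | hwX
        · exact h'.eq_of_mem_tail hw hwK
        · exact absurd hwX (hTX w hw))
      exact absurd (hm j' ⟨z, hz, a, ha, hza, H', M', T', i', k', h'⟩) (by omega)
    have hHM := h'.head_middle
    have hmem := h'.mem
    refine ⟨e, f, _, T', _, k', h'.middle.symm.trans he (by grind), hf, ?_, ?_, ?_, ?_⟩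
    · have := h'.length
      omega
    · rintro w (hw | hw)
      exacts [hMX' w hw, hHX w hw]
    · rintro w (hw | hw) <;> exact hmem w (by simp [hw])
    · intro w hw
      exact (hTX w hw).imp_left (h'.eq_of_mem_tail hw)
  obtain ⟨e₁, f₁, P₁, T₁, i₁, k₁, hP₁, hT₁, hl₁, hPX₁, hPK₁, hTX₁⟩ := key a ha b hb hza hzb h.middle
    fun w hw => h.mem w (by simp [hw])
  obtain ⟨e₂, f₂, P₂, T₂, i₂, k₂, hP₂, hT₂, hl₂, hPX₂, hPK₂, hTX₂⟩ := key b hb a ha hzb hza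
    h.middle.symm fun w hw hwK => (h.mem w (by simp [hw]) hwK).symm
  exact false_of_cross hmax (hK ha hb hab) hP₁ hT₁ hP₂ hT₂ hl₁ hl₂ (by grind) (by grind)

theorem exists_pathOn_inter_subsingleton (hK : G.IsClique K) (hne : K.Nonempty)
    (hcomp : ∀ x ∉ K, ∃ z ∈ K, ∀ y ∈ G.compOf K x, ¬ G.Adj z y)
    (hone : ∀ a, ∃ u v s, G.PathOn u v s L ∧ a ∉ s)
    (hpair : ∀ a ∈ K, ∀ b ∈ K, ∀ c ∈ K, a ≠ b → c ≠ a → c ≠ b →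
      ∃ u v s, G.PathOn u v s L ∧ ∀ w ∈ s, w ∈ K → w = a ∨ w = b) :
    ∃ v ∈ K, ∃ x y s, G.PathOn x y s L ∧ ∀ w ∈ s, w ∈ K → w = v := by
  by_cases h3 : ∃ a ∈ K, ∃ b ∈ K, ∃ c ∈ K, a ≠ b ∧ a ≠ c ∧ b ≠ c
  · obtain ⟨a, ha, b, hb, c, hc, hab, hac, hbc⟩ := h3
    refine exists_pathOn_inter_subsingleton_of_three hmax hK hcomp ?_ ha hb hc hab hac hbc
    intro a' ha' b' hb' hab'
    obtain ⟨c', hc', hca', hcb'⟩ := exists_mem_ne_ne ha hb hc hab hac hbc a' b'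
    exact hpair a' ha' b' hb' c' hc' hab' hca' hcb'
  · push Not at h3
    obtain ⟨a, ha⟩ := hne
    obtain ⟨u, v, s, hs, has⟩ := hone a
    by_cases hb : ∃ b ∈ K, b ≠ a
    · obtain ⟨b, hb, hba⟩ := hb
      exact ⟨b, hb, u, v, s, hs, fun w hw hwK => by grind⟩
    · exact ⟨a, ha, u, v, s, hs, fun w hw hwK => by grind⟩

end Recombination

/-! ### A longest path fenced in by the clique -/

section Fenced

variable {K : Set V} {L : ℕ}

/-- A path of length `L` through `v` that consists of two arms, which lie in different components
of the graph without `K`. -/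
structure IsCrossing (G : SimpleGraph V) (K : Set V) (L : ℕ) (v a b : V) (P Q : Set V)
    (i j : ℕ) : Prop where
  left : ∃ e, G.PathOn v e P i
  right : ∃ f, G.PathOn v f Q j
  length : i + j = L
  left_mem : a ∈ P
  right_mem : b ∈ Q
  left_notMem : a ∉ K
  right_notMem : b ∉ K
  left_subset : ∀ x ∈ P, x = v ∨ x ∈ G.compOf K a
  right_subset : ∀ x ∈ Q, x = v ∨ x ∈ G.compOf K b
  notMem : b ∉ G.compOf K a

theorem IsCrossing.symm {v a b : V} {P Q : Set V} {i j : ℕ}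
    (h : G.IsCrossing K L v a b P Q i j) : G.IsCrossing K L v b a Q P j i where
  left := h.right
  right := h.left
  length := by have := h.length; omega
  left_mem := h.right_mem
  right_mem := h.left_mem
  left_notMem := h.right_notMem
  right_notMem := h.left_notMem
  left_subset := h.right_subset
  right_subset := h.left_subset
  notMem hb := h.notMem (mem_compOf_of_mem_of_mem hb (mem_compOf_self h.right_notMem))

theorem PathOn.exists_isCrossing {v x y : V} {s : Set V} (h : G.PathOn x y s L) (hL : 0 < L)
    (hs : ∀ w ∈ s, w ∈ K → w = v) (hv : v ∈ K)
    (hcon : ∀ c ∉ K, ∃ w ∈ s, w ∉ K ∧ w ∉ G.compOf K c) :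
    ∃ a b P Q i j, G.IsCrossing K L v a b P Q i j := by
  obtain ⟨w, hw, hwK⟩ : ∃ w ∈ s, w ∉ K := by
    by_contra! hsK
    have h1 : s ⊆ {v} := fun w hw => hs w hw (hsK w hw)
    have h2 := Set.ncard_le_ncard h1 (Set.toFinite _)
    rw [h.ncard_eq, Set.ncard_singleton] at h2
    omega
  obtain ⟨w', hw', hwK', hne⟩ := hcon w hwK
  have hside : G.IsSide K (G.compOf K w) := isSide_compOf
  have hside' : G.IsSide K (G.compOf K w') := isSide_compOf
  -- Without `v` the path would avoid `K` and stay in one component.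
  have hvs : v ∈ s := by
    by_contra hvs
    rcases hside.dichotomy h (fun z hz hzK => absurd (hs z hz hzK ▸ hz) hvs) with h1 | h1
    · exact (h1 w' hw').elim hwK' hne
    · exact h1 w hw (mem_compOf_self hwK)
  obtain ⟨P, Q, i, j, hP, hQ, hij, hPQ, -⟩ := h.split hvs
  have hP := hP.symm
  have key : ∀ R e i, G.PathOn v e R i → (∀ z ∈ R, z ∈ s) → ∀ z ∈ R, z ∉ K →
      ∀ w ∈ R, w = v ∨ w ∈ G.compOf K z := by
    intro R e i hR hRs z hz hzK w hwR
    have h1 := (isSide_compOf (x := z)).dichotomy hR fun w hw hwK => .inl (hs w (hRs w hw) hwK)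
    rcases h1 with h1 | h1
    · exact (h1 w hwR).imp_left (hs w (hRs w hwR))
    · exact absurd (mem_compOf_self hzK) (h1 z hz)
  have hPs : ∀ z ∈ P, z ∈ s := by grind
  have hQs : ∀ z ∈ Q, z ∈ s := by grind
  rcases (hPQ w).1 hw with hwP | hwQ
  · have hw'Q : w' ∈ Q := by
      have := key P _ _ hP hPs w hwP hwK w'
      grind
    exact ⟨w, w', P, Q, i, j, ⟨_, hP⟩, ⟨_, hQ⟩, hij, hwP, hw'Q, hwK, hwK',
      key _ _ _ hP hPs _ hwP hwK, key _ _ _ hQ hQs _ hw'Q hwK', hne⟩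
  · have hw'P : w' ∈ P := by
      have := key Q _ _ hQ hQs w hwQ hwK w'
      grind
    exact ⟨w, w', Q, P, j, i, ⟨_, hQ⟩, ⟨_, hP⟩, by omega, hwQ, hw'P, hwK, hwK',
      key _ _ _ hQ hQs _ hwQ hwK, key _ _ _ hP hPs _ hw'P hwK', hne⟩

theorem IsCrossing.disjoint {v a b : V} {P Q : Set V} {i j : ℕ}
    (h : G.IsCrossing K L v a b P Q i j) {x : V} (hx : x ∈ G.compOf K b) : x ∉ G.compOf K a :=
  isSide_compOf.notMem_of_mem_compOf h.notMem hx

variable (hmax : ∀ u v s n, G.PathOn u v s n → n ≤ L)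
include hmax

/-- Each crossing has its two arms in two distinct components, so one of the two ways to pair the
arms of the first with those of the second has both pairs disjoint. -/
theorem IsCrossing.false_of_isCrossing {v a b u c d : V} {P Q R S : Set V} {i j k l : ℕ}
    (h : G.IsCrossing K L v a b P Q i j) (h' : G.IsCrossing K L u c d R S k l) (hv : v ∈ K)
    (hadj : G.Adj v u) : False := by
  obtain ⟨p, hP⟩ := h.left
  obtain ⟨q, hQ⟩ := h.right
  obtain ⟨r, hR⟩ := h'.left
  obtain ⟨s, hS⟩ := h'.right
  have hRK : ∀ w ∈ R, w ∈ K → w = u := fun w hw hwK =>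
    (h'.left_subset w hw).resolve_right fun h1 => isSide_compOf.notMem w h1 hwK
  have hSK : ∀ w ∈ S, w ∈ K → w = u := fun w hw hwK =>
    (h'.right_subset w hw).resolve_right fun h1 => isSide_compOf.notMem w h1 hwK
  have hvR : v ∉ R := fun h1 => hadj.ne (hRK v h1 hv)
  have hvS : v ∉ S := fun h1 => hadj.ne (hSK v h1 hv)
  have hA := (isSide_compOf (G := G) (K := K) (x := a)).dichotomy hR fun w hw hwK =>
    .inl (hRK w hw hwK)
  have hB := (isSide_compOf (G := G) (K := K) (x := b)).dichotomy hS fun w hw hwK =>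
    .inl (hSK w hw hwK)
  have hA' := (isSide_compOf (G := G) (K := K) (x := a)).dichotomy hS fun w hw hwK =>
    .inl (hSK w hw hwK)
  have hB' := (isSide_compOf (G := G) (K := K) (x := b)).dichotomy hR fun w hw hwK =>
    .inl (hRK w hw hwK)
  have hdisj := fun x => h.disjoint (x := x)
  have hP' := h.left_subset
  have hQ' := h.right_subset
  have hc := h'.left_mem
  have hd := h'.right_mem
  have hcK := h'.left_notMem
  have hdK := h'.right_notMem
  have hA2 : c ∈ G.compOf K a → d ∉ G.compOf K a := fun h1 h2 =>
    h'.notMem (mem_compOf_of_mem_of_mem h1 h2)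
  have hB2 : c ∈ G.compOf K b → d ∉ G.compOf K b := fun h1 h2 =>
    h'.notMem (mem_compOf_of_mem_of_mem h1 h2)
  have hl := h.length
  have hl' := h'.length
  by_cases hcross : (∀ w ∈ P, w ∉ S) ∧ ∀ w ∈ Q, w ∉ R
  · exact false_of_cross hmax hadj hP hQ hR hS hl hl' hcross.1 hcross.2
  · refine false_of_cross hmax hadj hP hQ hS hR hl (by omega) ?_ ?_
    · intro w hw hw'
      clear hP hQ hR hS hmax h h'
      rcases hA with hA | hA <;> rcases hA' with hA' | hA' <;> rcases hB' with hB' | hB' <;>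
        rcases hB with hB | hB <;> grind
    · intro w hw hw'
      clear hP hQ hR hS hmax h h'
      rcases hA with hA | hA <;> rcases hA' with hA' | hA' <;> rcases hB' with hB' | hB' <;>
        rcases hB with hB | hB <;> grind

/-- Write A and B for the components of `a` and `b`. A part of the cut path that begins at a vertex
without neighbours in A (or B) avoids that component. If `y` has no neighbour in B, cut the second
path at `x`: `H` avoids A and the rest avoids B. If `x` has none in B, cut at `y`: `H` and `M` avoid
A and B, and `T` cannot meet both. -/
theorem IsCrossing.false_of_isCutPath {v a b x y : V} {P Q H M T : Set V} {i j k l m : ℕ}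
    (h : G.IsCrossing K L v a b P Q i j) (h' : G.IsCutPath K L x y H M T k l m) (hK : G.IsClique K)
    (hv : v ∈ K) (hx : x ∈ K) (hy : y ∈ K) (hvx : v ≠ x) (hvy : v ≠ y)
    (hxa : ∀ w ∈ G.compOf K a, ¬ G.Adj x w)
    (hb : (∀ w ∈ G.compOf K b, ¬ G.Adj y w) ∨ ∀ w ∈ G.compOf K b, ¬ G.Adj x w) : False := by
  obtain ⟨p, hP⟩ := h.left
  obtain ⟨q, hQ⟩ := h.right
  obtain ⟨r, hH⟩ := h'.head
  obtain ⟨s, hT⟩ := h'.tail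
  have hM := h'.middle
  have hA : G.IsSide K (G.compOf K a) := isSide_compOf
  have hB : G.IsSide K (G.compOf K b) := isSide_compOf
  have hHK : ∀ w ∈ H, w ∈ K → w = x ∨ w = r := fun w hw hwK => .inl (h'.eq_of_mem_head hw hwK)
  have hTK : ∀ w ∈ T, w ∈ K → w = y ∨ w = s := fun w hw hwK => .inl (h'.eq_of_mem_tail hw hwK)
  have hMK : ∀ w ∈ M, w ∈ K → w = x ∨ w = y := fun w hw hwK => h'.mem w (by simp [hw]) hwK
  have hHA := hA.notMem_of_not_adj hH hHK hx hxa
  have hMA := hA.notMem_of_not_adj hM hMK hx hxa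
  have hvmem : ∀ w, w ∈ H ∨ w ∈ M ∨ w ∈ T → w ≠ v := by
    rintro w hw rfl
    exact (h'.mem w hw hv).elim hvx hvy
  have hP' := h.left_subset
  have hQ' := h.right_subset
  have hl := h.length
  have hl' := h'.length
  have h1 := h'.head_middle
  have h2 := h'.middle_tail
  have h3 := h'.head_tail
  rcases hb with hb | hb
  · have hTB := hB.notMem_of_not_adj hT hTK hy hb
    have hMB := hB.notMem_of_not_adj hM.symm (fun w hw hwK => (hMK w hw hwK).symm) hy hb
    refine false_of_cross hmax (hK hv hx hvx) hQ hP hH (hM.trans hT h2) (by omega) (by omega) ?_ ?_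
    · rintro w hw (hw' | hw') <;> grind
    · intro w hw hw'
      grind
  · have hHB := hB.notMem_of_not_adj hH hHK hx hb
    have hMB := hB.notMem_of_not_adj hM hMK hx hb
    have hMH := hM.symm.trans hH (by grind)
    by_cases hTA : ∀ w ∈ T, w ∉ G.compOf K a
    · refine false_of_cross hmax (hK hv hy hvy) hQ hP hT hMH (by omega) (by omega) ?_ ?_
      · rintro w hw (hw' | hw') <;> grind
      · intro w hw hw'
        grind
    · have hTB := (hA.dichotomy hT hTK).resolve_right hTA
      have := fun x => h.disjoint (x := x)
      have := hB.notMem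
      refine false_of_cross hmax (hK hv hy hvy) hP hQ hT hMH (by omega) (by omega) ?_ ?_
      · rintro w hw (hw' | hw') <;> grind
      · intro w hw hw'
        grind

/-- Some longest path lies, up to at most one vertex, in one component of the graph without `K`. -/
theorem exists_fenced_pathOn (hK : G.IsClique K) (hne : K.Nonempty) (hL : 0 < L)
    (hcomp : ∀ x ∉ K, ∃ z ∈ K, ∀ y ∈ G.compOf K x, ¬ G.Adj z y)
    (hone : ∀ a, ∃ u v s, G.PathOn u v s L ∧ a ∉ s)
    (hpair : ∀ a ∈ K, ∀ b ∈ K, ∀ c ∈ K, a ≠ b → c ≠ a → c ≠ b →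
      ∃ u v s, G.PathOn u v s L ∧ ∀ w ∈ s, w ∈ K → w = a ∨ w = b) :
    ∃ v ∈ K, ∃ c ∉ K, ∃ x y s, G.PathOn x y s L ∧ (∀ w ∈ s, w ∈ K → w = v) ∧
      ∀ w ∈ s, w ∈ K ∨ w ∈ G.compOf K c := by
  by_contra! hcon
  have hcross : ∀ v ∈ K, ∀ x y s, G.PathOn x y s L → (∀ w ∈ s, w ∈ K → w = v) →
      ∃ a b P Q i j, G.IsCrossing K L v a b P Q i j := fun v hv x y s h hs =>
    h.exists_isCrossing hL hs hv fun c hc => hcon v hv c hc x y s h hs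
  obtain ⟨v, hv, x₀, y₀, s₀, h₀, hs₀⟩ :=
    exists_pathOn_inter_subsingleton hmax hK hne hcomp hone hpair
  obtain ⟨a, b, P, Q, i, j, h⟩ := hcross v hv x₀ y₀ s₀ h₀ hs₀
  have hsingle : ∀ u ∈ K, v ≠ u → ∀ x y s, G.PathOn x y s L → ¬ ∀ w ∈ s, w ∈ K → w = u := by
    intro u hu hvu x y s hs hsu
    obtain ⟨c, d, R, S, k, l, h'⟩ := hcross u hu x y s hs hsu
    exact h.false_of_isCrossing hmax h' hv (hK hv hu hvu)
  -- The arm from `v` to the component of `a` gives `v` a neighbour there.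
  have hroot : ∀ a b P Q i j, G.IsCrossing K L v a b P Q i j →
      ∀ x ∈ K, (∀ y ∈ G.compOf K a, ¬ G.Adj x y) → v ≠ x := by
    rintro a b P Q i j h x hx hxa rfl
    obtain ⟨p, hP⟩ := h.left
    refine isSide_compOf.notMem_of_not_adj hP (fun w hw hwK => ?_) hx hxa a h.left_mem
      (mem_compOf_self h.left_notMem)
    exact .inl ((h.left_subset w hw).resolve_right fun h1 => isSide_compOf.notMem w h1 hwK)
  obtain ⟨x, hx, hxa⟩ := hcomp a h.left_notMem
  obtain ⟨y, hy, hyb⟩ := hcomp b h.right_notMem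
  have hvx := hroot _ _ _ _ _ _ h x hx hxa
  have hvy := hroot _ _ _ _ _ _ h.symm y hy hyb
  have key : ∀ z ∈ K, v ≠ z → x ≠ z →
      ((∀ w ∈ G.compOf K b, ¬ G.Adj z w) ∨ ∀ w ∈ G.compOf K b, ¬ G.Adj x w) → False := by
    intro z hz hvz hxz hb
    obtain ⟨e, f, s, hs, hsK⟩ := hpair x hx z hz v hv hxz hvx hvz
    by_cases hxs : x ∈ s
    · by_cases hzs : z ∈ s
      · obtain ⟨H, M, T, k, l, m, h'⟩ := hs.exists_isCutPath hxs hzs hxz hsK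
        exact h.false_of_isCutPath hmax h' hK hv hx hz hvx hvz hxa hb
      · exact hsingle x hx hvx e f s hs fun w hw hwK => (hsK w hw hwK).resolve_right
          fun h1 => hzs (h1 ▸ hw)
    · exact hsingle z hz hvz e f s hs fun w hw hwK => (hsK w hw hwK).resolve_left
        fun h1 => hxs (h1 ▸ hw)
  -- If `x = y`, any third vertex of `K` can serve as the second cut vertex; if there is none, a
  -- longest path that misses `v` meets `K` at most in `x`.
  by_cases hxy : x = y
  · subst hxy
    by_cases hz : ∃ z ∈ K, v ≠ z ∧ x ≠ z
    · obtain ⟨z, hz, hvz, hxz⟩ := hz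
      exact key z hz hvz hxz (.inr hyb)
    · obtain ⟨e, f, s, hs, hvs⟩ := hone v
      exact hsingle x hx hvx e f s hs fun w hw hwK => by grind
  · exact key y hy hvy hxy (.inl hyb)

end Fenced

/-! ### Chordality and the boundary of a component -/

/-- A walk with a chord can be shortened. -/
theorem Walk.exists_shorter_of_chord {a b : V} (p : G.Walk a b) {x y : V} (hx : x ∈ p.support)
    (hy : y ∈ p.support) (hxy : G.Adj x y) (he : s(x, y) ∉ p.edges) :
    ∃ q : G.Walk a b, q.length < p.length ∧ ∀ w ∈ q.support, w ∈ p.support := by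
  classical
  induction p with
  | nil =>
    simp only [Walk.support_nil, List.mem_singleton] at hx hy
    exact absurd (hx.trans hy.symm) hxy.ne
  | @cons a c b h p ih =>
    rw [Walk.edges_cons, List.mem_cons, not_or] at he
    have key : ∀ z (hz : z ∈ p.support), G.Adj a z → z ≠ c →
        ∃ q : G.Walk a b, q.length < (Walk.cons h p).length ∧
          ∀ w ∈ q.support, w ∈ (Walk.cons h p).support := by
      intro z hz haz hzc
      refine ⟨.cons haz (p.dropUntil z hz), ?_, ?_⟩
      · simpa using p.length_dropUntil_lt_length hz hzc
      · intro w hw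
        simp only [Walk.support_cons, List.mem_cons] at hw ⊢
        exact hw.imp_right fun hw => p.support_dropUntil_subset_support hz hw
    rw [Walk.support_cons, List.mem_cons] at hx hy
    rcases hx with rfl | hx <;> rcases hy with rfl | hy
    · exact absurd rfl hxy.ne
    · exact key y hy hxy fun h => he.1 (by rw [h])
    · exact key x hx hxy.symm fun h => he.1 (by rw [h, Sym2.eq_swap])
    · obtain ⟨q, hq, hqs⟩ := ih hx hy he.2
      refine ⟨.cons h q, by simpa using hq, ?_⟩
      intro w hw
      simp only [Walk.support_cons, List.mem_cons] at hw ⊢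
      exact hw.imp_right (hqs w)

/-- In a chordal graph, a walk that joins neighbours of two adjacent vertices `x` and `y` contains
a common neighbour of `x` and `y`. -/
theorem IsChordal.exists_common_neighbor (hG : G.IsChordal) {x y : V} (hxy : G.Adj x y)
    {s : Set V} (hxs : x ∉ s) (hys : y ∉ s)
    (hwalk : ∃ (a b : V) (p : G.Walk a b), G.Adj y a ∧ G.Adj b x ∧ ∀ w ∈ p.support, w ∈ s) :
    ∃ w ∈ s, G.Adj w x ∧ G.Adj w y := by
  classical
  have hex : ∃ n, ∃ (a b : V) (p : G.Walk a b), G.Adj y a ∧ G.Adj b x ∧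
      (∀ w ∈ p.support, w ∈ s) ∧ p.length = n := by
    obtain ⟨a, b, p, h1, h2, h3⟩ := hwalk
    exact ⟨_, a, b, p, h1, h2, h3, rfl⟩
  -- A shortest such walk, closed up through `x` and `y`, is a chordless cycle of length `p.length +
  -- 3`. Hence `p` is a single vertex.
  obtain ⟨a, b, p, hya, hbx, hps, hlen⟩ := Nat.find_spec hex
  have hmin : ∀ (c d : V) (q : G.Walk c d), G.Adj y c → G.Adj d x → (∀ w ∈ q.support, w ∈ p.support)
      → p.length ≤ q.length := fun c d q h1 h2 h3 =>
    hlen ▸ Nat.find_min' hex ⟨c, d, q, h1, h2, fun w hw => hps w (h3 w hw), rfl⟩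
  have hpath : p.IsPath := by
    have := p.bypass_eq_self_of_length_le_length_bypass
      (hmin _ _ _ hya hbx fun w hw => p.support_bypass_subset_support hw)
    exact this ▸ p.bypass_isPath
  have hy' : ∀ w ∈ p.support, G.Adj y w → w = a := by
    intro w hw hyw
    by_contra hne
    exact absurd (hmin _ _ _ hyw hbx fun z hz => p.support_dropUntil_subset_support hw hz)
      (not_le.2 (p.length_dropUntil_lt_length hw hne))
  have hx' : ∀ w ∈ p.support, G.Adj w x → w = b := by
    intro w hw hwx
    by_contra hne
    exact absurd (hmin _ _ _ hya hwx fun z hz => p.support_takeUntil_subset_support hw hz)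
      (not_le.2 (p.length_takeUntil_lt_length hw hne))
  have hchord : ∀ w ∈ p.support, ∀ z ∈ p.support, G.Adj w z → s(w, z) ∈ p.edges := by
    intro w hw z hz hwz
    by_contra he
    obtain ⟨q, hq, hqs⟩ := p.exists_shorter_of_chord hw hz hwz he
    exact absurd (hmin _ _ _ hya hbx hqs) (not_le.2 hq)
  have hxp : x ∉ p.support := fun h => hxs (hps x h)
  have hyp : y ∉ p.support := fun h => hys (hps y h)
  let c : G.Walk y y := .cons hya ((p.concat hbx).concat hxy)
  have hc : c.IsCycle := by
    rw [Walk.cons_isCycle_iff]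
    refine ⟨?_, ?_⟩
    · rw [Walk.concat_isPath_iff, Walk.concat_isPath_iff]
      refine ⟨⟨hpath, hxp⟩, ?_⟩
      rw [Walk.support_concat, List.mem_append, List.mem_singleton, not_or]
      exact ⟨hyp, hxy.ne'⟩
    · have hya' : s(y, a) ∉ p.edges := fun h => hyp (p.fst_mem_support_of_mem_edges h)
      have hap := p.start_mem_support
      have hbp := p.end_mem_support
      simp only [Walk.edges_concat, List.concat_eq_append, List.mem_append, List.mem_singleton,
        Sym2.eq_iff]
      rintro ((h | ⟨rfl, -⟩ | ⟨rfl, -⟩) | ⟨rfl, -⟩ | ⟨-, rfl⟩)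
      exacts [hya' h, hyp hbp, hxy.ne rfl, hxy.ne rfl, hxp hap]
  have hless : c.IsChordless := by
    rw [Walk.isChordless_iff_forall_mem_edges]
    have hcs : ∀ w ∈ c.support, w = y ∨ w = x ∨ w ∈ p.support := by
      intro w hw
      simp only [c, Walk.support_cons, Walk.support_concat, List.mem_cons, List.mem_append,
        List.not_mem_nil, or_false] at hw
      tauto
    have hce : ∀ e, e ∈ c.edges ↔ e = s(y, a) ∨ e ∈ p.edges ∨ e = s(b, x) ∨ e = s(x, y) := by
      intro e
      simp only [c, Walk.edges_cons, Walk.edges_concat, List.concat_eq_append, List.mem_cons,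
        List.mem_append, List.not_mem_nil, or_false, or_assoc]
    intro w z hw hz hwz
    rw [hce]
    have hne := hwz.ne
    have := hy' w
    have := hy' z
    have := hx' w
    have := hx' z
    have := hwz.symm
    have h5 : s(w, z) = s(z, w) := Sym2.eq_swap
    rcases hcs w hw with rfl | rfl | hw <;> rcases hcs z hz with rfl | rfl | hz <;> grind
  have h3 := hG c hc hless
  have h0 : p.length = 0 := by simpa [c] using h3
  obtain rfl := Walk.eq_of_length_eq_zero h0
  exact ⟨a, hps a p.start_mem_support, hbx, hya.symm⟩

/-- In a chordal graph, a component of the graph without a clique `K` contains a vertex that is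
adjacent to all vertices of `K` with a neighbour in this component. -/
theorem IsChordal.exists_adj_boundary [Finite V] (hG : G.IsChordal) {K : Set V}
    (hK : G.IsClique K) {c₀ : V} (hc₀ : c₀ ∉ K) :
    ∃ c ∈ G.compOf K c₀, ∀ x ∈ K, (∃ y ∈ G.compOf K c₀, G.Adj x y) → G.Adj x c := by
  classical
  -- Take `c` with an inclusion-maximal neighbourhood in `K`. If `x` is missed, let `d` be the first
  -- neighbour of `x` on a shortest way from `c`: every neighbour of `c` in `K` is then adjacent to
  -- `d`, and so is `x`, against maximality.
  obtain ⟨c, hc, hmax⟩ := (Set.toFinite (G.compOf K c₀)).exists_maximalFor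
    (fun c => {x | x ∈ K ∧ G.Adj x c}) _ ⟨c₀, mem_compOf_self hc₀⟩
  refine ⟨c, hc, fun x hx ⟨y, hy, hxy⟩ => ?_⟩
  by_contra hxc
  have hex : ∃ n, ∃ (d : V) (p : G.Walk c d), (∀ w ∈ p.support, w ∉ K) ∧ G.Adj d x ∧
      p.length = n := by
    obtain ⟨p, hp⟩ := mem_compOf_of_mem_of_mem hc hy
    exact ⟨_, y, p, hp, hxy.symm, rfl⟩
  obtain ⟨d, p, hpK, hdx, hlen⟩ := Nat.find_spec hex
  have hpx : ∀ w ∈ p.support, G.Adj w x → w = d := by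
    intro w hw hwx
    by_contra hne
    have h1 := Nat.find_min' hex ⟨w, p.takeUntil w hw,
      fun z hz => hpK z (p.support_takeUntil_subset_support hw hz), hwx, rfl⟩
    exact absurd (p.length_takeUntil_lt_length hw hne) (by omega)
  have hd : d ∈ G.compOf K c₀ := by
    obtain ⟨q, hq⟩ := hc
    refine ⟨q.append p, fun w hw => ?_⟩
    rw [Walk.mem_support_append_iff] at hw
    exact hw.elim (hq w) (hpK w)
  refine hxc (hmax hd (fun z ⟨hz, hzc⟩ => ⟨hz, ?_⟩) ⟨hx, hdx.symm⟩).2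
  have hxz : G.Adj x z := hK hx hz fun h => hxc (h ▸ hzc)
  obtain ⟨w, hw, hwx, hwz⟩ := hG.exists_common_neighbor hxz (s := {w | w ∈ p.support})
    (fun h => hpK x h hx) (fun h => hpK z h hz) ⟨c, d, p, hzc, hdx, fun w hw => hw⟩
  exact hpx w hw hwx ▸ hwz.symm

/-! ### Longest paths meet -/

/-- One of the two parts into which a vertex cuts a path has at least half its length. -/
theorem PathOn.exists_long_arm {u v a : V} {s : Set V} {n : ℕ} (h : G.PathOn u v s n)
    (ha : a ∈ s) : ∃ e t i, G.PathOn a e t i ∧ n ≤ 2 * i ∧ ∀ w ∈ t, w ∈ s := by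
  obtain ⟨s₁, s₂, n₁, n₂, h₁, h₂, hn, hmem, -⟩ := h.split ha
  rcases le_total n₁ n₂ with hle | hle
  · exact ⟨v, s₂, n₂, h₂, by omega, fun w hw => (hmem w).2 (.inr hw)⟩
  · exact ⟨u, s₁, n₁, h₁.symm, by omega, fun w hw => (hmem w).2 (.inl hw)⟩

/-- Two longest paths of a connected graph have a common vertex. -/
theorem Connected.exists_mem_of_longest (hG : G.Connected) {L : ℕ}
    (hmax : ∀ u v s n, G.PathOn u v s n → n ≤ L) {u v x y : V} {s t : Set V}
    (hs : G.PathOn u v s L) (ht : G.PathOn x y t L) : ∃ w ∈ s, w ∈ t := by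
  classical
  by_contra! hst
  have hex : ∃ n, ∃ a ∈ s, ∃ b ∈ t, ∃ r, G.PathOn a b r n := by
    obtain ⟨p⟩ := hG.preconnected u x
    obtain ⟨r, n, h, -, -⟩ := PathOn.of_walk p
    exact ⟨n, u, hs.start_mem, x, ht.start_mem, r, h⟩
  -- A shortest connection meets each path only at its end; with a long arm on either side it yields
  -- a path with more than `L` edges.
  obtain ⟨a, ha, b, hb, r, hr⟩ := Nat.find_spec hex
  have hmin : ∀ a ∈ s, ∀ b ∈ t, ∀ r n, G.PathOn a b r n → Nat.find hex ≤ n :=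
    fun a ha b hb r n h => Nat.find_min' hex ⟨a, ha, b, hb, r, h⟩
  generalize Nat.find hex = n at hr hmin
  have hrs : ∀ w ∈ s, w ∈ r → w = a := by
    intro w hws hw
    obtain ⟨r₁, r₂, n₁, n₂, h₁, h₂, hn, -, -⟩ := hr.split hw
    have := hmin w hws b hb _ _ h₂
    obtain rfl : n₁ = 0 := by omega
    exact h₁.eq_of_length_zero.symm
  have hrt : ∀ w ∈ r, w ∈ t → w = b := by
    intro w hw hwt
    obtain ⟨r₁, r₂, n₁, n₂, h₁, h₂, hn, -, -⟩ := hr.split hw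
    have := hmin a ha w hwt _ _ h₁
    obtain rfl : n₂ = 0 := by omega
    exact h₂.eq_of_length_zero
  have hn : n ≠ 0 := by
    rintro rfl
    exact hst a ha (hr.eq_of_length_zero ▸ hb)
  obtain ⟨e, s', i, hs', hi, hss⟩ := hs.exists_long_arm ha
  obtain ⟨f, t', j, ht', hj, htt⟩ := ht.exists_long_arm hb
  have h1 := hs'.symm.trans hr fun w hw hwr => hrs w (hss w hw) hwr
  have h2 := h1.trans ht' (by
    rintro w (hw | hw) hwt
    · exact absurd (htt w hwt) (hst w (hss w hw))
    · exact hrt w hw (htt w hwt))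
  have := hmax _ _ _ _ h2
  omega

/-! ### Maximal cliques -/

/-- A version of maximality of a clique that refers to single vertices. -/
def IsMaxClique (G : SimpleGraph V) (K : Set V) : Prop :=
  G.IsClique K ∧ ∀ x ∉ K, ∃ z ∈ K, ¬ G.Adj z x

theorem IsClique.exists_isMaxClique [Finite V] {S : Set V} (hS : G.IsClique S) :
    ∃ K, S ⊆ K ∧ G.IsMaxClique K := by
  obtain ⟨K, hSK, hK⟩ := (Set.toFinite {K | G.IsClique K}).exists_le_maximal hS
  refine ⟨K, hSK, hK.prop, fun x hx => ?_⟩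
  by_contra! h
  have h1 : G.IsClique (Insert.insert x K) := hK.prop.insert fun z hz _ => (h z hz).symm
  exact hx (hK.le_of_ge h1 (Set.subset_insert x K) (Set.mem_insert x K))

theorem IsMaxClique.exists_not_adj_compOf [Finite V] (hG : G.IsChordal) {K : Set V}
    (hK : G.IsMaxClique K) : ∀ x ∉ K, ∃ z ∈ K, ∀ y ∈ G.compOf K x, ¬ G.Adj z y := by
  intro x hx
  obtain ⟨c, hc, hadj⟩ := hG.exists_adj_boundary hK.1 hx
  obtain ⟨z, hz, hzc⟩ := hK.2 c (isSide_compOf.notMem c hc)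
  exact ⟨z, hz, fun y hy hzy => hzc (hadj z hz ⟨y, hy, hzy⟩)⟩

theorem PathOn.notMem_of_subsingleton {u v x y : V} {s : Set V} {n : ℕ}
    (h : G.PathOn u v s n) (hn : 0 < n) (hs : ∀ w ∈ s, w = x) : y ∉ s := by
  have h2 := Set.ncard_le_ncard (show s ⊆ {x} from hs) (Set.toFinite _)
  rw [h.ncard_eq, Set.ncard_singleton] at h2
  omega

/-! ### The smallest fenced component -/

/-- If two longest paths meet a clique `S` only in `v` and lie on different sides of `S`, then
every longest path with at most one vertex in `S` contains `v`. -/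
theorem false_of_two_sides (hconn : G.Connected) {L : ℕ}
    (hmax : ∀ u v s n, G.PathOn u v s n → n ≤ L) {S C : Set V} (hS : G.IsClique S)
    (hC : G.IsSide S C) {v x y x' y' e f u : V} {s s' r : Set V} (hv : v ∈ S)
    (hs : G.PathOn x y s L) (hs' : G.PathOn x' y' s' L) (hvs : v ∈ s) (hvs' : v ∈ s')
    (hsC : ∀ w ∈ s, w = v ∨ w ∈ C) (hsC' : ∀ w ∈ s', w = v ∨ w ∉ S ∧ w ∉ C)
    (hr : G.PathOn e f r L) (hvr : v ∉ r) (hu : u ∈ S) (hrS : ∀ w ∈ r, w ∈ S → w = u) : False := by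
  obtain ⟨p, hpr, hps⟩ := hconn.exists_mem_of_longest hmax hr hs
  obtain ⟨q, hqr, hqs⟩ := hconn.exists_mem_of_longest hmax hr hs'
  have hpC : p ∈ C := (hsC p hps).resolve_left fun h => hvr (h ▸ hpr)
  have hqC : q ∉ S ∧ q ∉ C := (hsC' q hqs).resolve_left fun h => hvr (h ▸ hqr)
  have hur : u ∈ r := by
    by_contra hur
    rcases hC.dichotomy hr (fun w hw hwS => absurd (hrS w hw hwS ▸ hw) hur) with h | h
    · exact (h q hqr).elim hqC.1 hqC.2
    · exact h p hpr hpC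
  obtain ⟨_, P, i, hP, hi, hPs⟩ := hs.exists_long_arm hvs
  obtain ⟨_, Q, j, hQ, hj, hQs⟩ := hs'.exists_long_arm hvs'
  -- The path `r` changes sides at `u`, with `A` on the side `C` and `B` off it. Through the edge
  -- `vu`, the long arm of `s` is joined to `B` and that of `s'` to `A`.
  have key : ∀ {a b A B k l}, G.PathOn u a A k → G.PathOn u b B l → k + l = L →
      (∀ w ∈ r, w ∈ A ∨ w ∈ B) → (∀ w ∈ A, w ∈ r) → (∀ w ∈ B, w ∈ r) → p ∈ A → False := by
    intro a b A B k l hA hB hkl hAB hAr hBr hpA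
    have h1 := (hC.dichotomy hA fun w hw hwS => .inl (hrS w (hAr w hw) hwS)).resolve_right
      fun h => h p hpA hpC
    have hqB : q ∈ B := (hAB q hqr).resolve_left fun h => (h1 q h).elim hqC.1 hqC.2
    have h2 := (hC.dichotomy hB fun w hw hwS => .inl (hrS w (hBr w hw) hwS)).resolve_left
      fun h => (h q hqB).elim hqC.1 hqC.2
    have hadj : G.Adj v u := hS hv hu fun h => hvr (h ▸ hur)
    have h3 := hmax _ _ _ _ (hP.symm.trans_adj hadj hB fun w hw hwB =>
      (hsC w (hPs w hw)).elim (fun h => hvr (h ▸ hBr w hwB)) (h2 w hwB))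
    have h4 := hmax _ _ _ _ (hQ.symm.trans_adj hadj hA fun w hw hwA =>
      (hsC' w (hQs w hw)).elim (fun h => hvr (h ▸ hAr w hwA))
        fun h => (h1 w hwA).elim h.1 h.2)
    omega
  obtain ⟨A, B, k, l, hA, hB, hkl, hAB, -⟩ := hr.split hur
  rcases (hAB p).1 hpr with h | h
  · exact key hA.symm hB hkl (by grind) (by grind) (by grind) h
  · exact key hB hA.symm (by omega) (by grind) (by grind) (by grind) h

theorem false_of_longest_avoid [Finite V] (hconn : G.Connected) (hG : G.IsChordal) {L : ℕ}
    (hmax : ∀ u v s n, G.PathOn u v s n → n ≤ L)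
    (havoid : ∀ S : Set V, S.ncard ≤ max 1 (G.cliqueNum - 2) →
      ∃ u v s, G.PathOn u v s L ∧ ∀ w ∈ S, w ∉ s) : False := by
  classical
  have hone : ∀ a, ∃ u v s, G.PathOn u v s L ∧ a ∉ s := by
    intro a
    obtain ⟨u, v, s, hs, ha⟩ := havoid {a} (by simp)
    exact ⟨u, v, s, hs, ha a rfl⟩
  have hL : 0 < L := by
    obtain ⟨a⟩ := hconn.nonempty
    obtain ⟨u, v, s, hs, ha⟩ := hone a
    obtain ⟨p⟩ := hconn.preconnected u a
    obtain ⟨r, n, hr, -, -⟩ := PathOn.of_walk p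
    have := hmax _ _ _ _ hr
    rcases Nat.eq_zero_or_pos n with rfl | hn
    · exact absurd (hr.eq_of_length_zero ▸ hs.start_mem) ha
    · omega
  have hcard : ∀ K, G.IsClique K → K.ncard ≤ G.cliqueNum := by
    intro K hK
    have h1 : G.IsClique (K.toFinite.toFinset : Set V) := by simpa using hK
    have := h1.card_le_cliqueNum
    rwa [← Set.ncard_eq_toFinset_card K] at this
  have hfenced : ∀ K, G.IsMaxClique K → ∃ v ∈ K, ∃ c ∉ K, ∃ x y s, G.PathOn x y s L ∧
      (∀ w ∈ s, w ∈ K → w = v) ∧ ∀ w ∈ s, w ∈ K ∨ w ∈ G.compOf K c := by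
    intro K hK
    refine exists_fenced_pathOn hmax hK.1 ?_ hL (hK.exists_not_adj_compOf hG) hone ?_
    · by_contra hne
      rw [Set.not_nonempty_iff_eq_empty] at hne
      obtain ⟨a⟩ := hconn.nonempty
      obtain ⟨z, hz, -⟩ := hK.2 a (by simp [hne])
      simp [hne] at hz
    · intro a ha b hb c hc hab hca hcb
      have h1 : (K \ {a, b}).ncard = K.ncard - 2 := by
        rw [Set.ncard_sdiff (Set.pair_subset ha hb), Set.ncard_pair hab]
      obtain ⟨u, v, s, hs, hsK⟩ := havoid (K \ {a, b}) (by
        have := hcard K hK.1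
        omega)
      refine ⟨u, v, s, hs, fun w hw hwK => ?_⟩
      by_contra hne
      exact hsK w ⟨hwK, hne⟩ hw
  -- a fenced longest path with the smallest possible component
  have hex : ∃ n, ∃ K, G.IsMaxClique K ∧ ∃ v ∈ K, ∃ c ∉ K, ∃ x y s, G.PathOn x y s L ∧
      (∀ w ∈ s, w ∈ K → w = v) ∧ (∀ w ∈ s, w ∈ K ∨ w ∈ G.compOf K c) ∧
      (G.compOf K c).ncard = n := by
    obtain ⟨K, -, hK⟩ := (G.isClique_empty).exists_isMaxClique
    obtain ⟨v, hv, c, hc, x, y, s, h1, h2, h3⟩ := hfenced K hK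
    exact ⟨_, K, hK, v, hv, c, hc, x, y, s, h1, h2, h3, rfl⟩
  obtain ⟨K, hK, v, hv, c₀, hc₀, x, y, s, hs, hsK, hsC, hn⟩ := Nat.find_spec hex
  have hmin : ∀ K', G.IsMaxClique K' → ∀ v ∈ K', ∀ c ∉ K', ∀ x y s, G.PathOn x y s L →
      (∀ w ∈ s, w ∈ K' → w = v) → (∀ w ∈ s, w ∈ K' ∨ w ∈ G.compOf K' c) →
      (G.compOf K c₀).ncard ≤ (G.compOf K' c).ncard :=
    fun K' hK' v hv c hc x y s h1 h2 h3 =>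
      hn ▸ Nat.find_min' hex ⟨K', hK', v, hv, c, hc, x, y, s, h1, h2, h3, rfl⟩
  clear hn hex
  obtain ⟨c, hcC, hcadj⟩ := hG.exists_adj_boundary hK.1 hc₀
  obtain ⟨z₀, hz₀, hz₀C⟩ := hK.exists_not_adj_compOf hG c₀ hc₀
  set C := G.compOf K c₀ with hC
  have hCK : G.IsSide K C := isSide_compOf
  set S : Set V := {x | x ∈ K ∧ ∃ y ∈ C, G.Adj x y} with hSdef
  have hSK : ∀ x ∈ S, x ∈ K := fun x hx => hx.1
  have hSC : ∀ x ∈ C, x ∉ S := fun x hx hxS => hCK.notMem x hx hxS.1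
  have hCS : ∀ x ∈ C, ∀ y, G.Adj x y → y ∉ S → y ∈ C := fun x hx y hxy hy =>
    hCK.mem_of_adj x hx y hxy fun hyK => hy ⟨hyK, x, hx, hxy.symm⟩
  have hCside : G.IsSide S C := ⟨hSC, hCS⟩
  -- The vertex `z₀` of `K` has no neighbour in `C`, so it is not in `S`.
  have hScard : S.ncard ≤ G.cliqueNum - 1 := by
    have h1 : S ⊆ K \ {z₀} := fun x hx => ⟨hx.1, by
      rintro rfl
      obtain ⟨-, y, hy, hxy⟩ := hx
      exact hz₀C y hy hxy⟩
    have h2 := Set.ncard_le_ncard h1 (Set.toFinite _)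
    rw [Set.ncard_sdiff_singleton_of_mem hz₀] at h2
    have := hcard K hK.1
    omega
  have hScl : G.IsClique S := fun a ha b hb hab => hK.1 ha.1 hb.1 hab
  have hSc : G.IsClique (insert c S) :=
    hScl.insert fun z hz _ => (hcadj z hz.1 hz.2).symm
  obtain ⟨K', hSK', hK'⟩ := hSc.exists_isMaxClique
  have hcK' : c ∈ K' := hSK' (Set.mem_insert c S)
  have hSK'' : ∀ x ∈ S, x ∈ K' := fun x hx => hSK' (Set.mem_insert_of_mem c hx)
  have hK'S : ∀ x ∈ K', x ∈ S ∨ x ∈ C := by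
    intro x hx
    by_cases hxc : x = c
    · exact .inr (hxc ▸ hcC)
    · by_contra! h
      exact h.2 (hCS c hcC x (hK'.1 hcK' hx (Ne.symm hxc)) h.1)
  obtain ⟨v', hv', d, hd, x', y', s', hs', hsK', hsC'⟩ := hfenced K' hK'
  set C' := G.compOf K' d with hC'
  have hCK' : G.IsSide K' C' := isSide_compOf
  -- Otherwise `C'` would lie in `C` without `c`, against the minimality of `C`.
  have hdC : d ∉ C := by
    intro hdC
    have hside : G.IsSide K' (C \ K') := ⟨fun x hx => hx.2, fun x hx y hxy hy =>
      ⟨hCS x hx.1 y hxy fun h => hy (hSK'' y h), hy⟩⟩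
    have h1 : C' ⊆ C \ K' := hside.compOf_subset ⟨hdC, hd⟩
    have h2 : C' ⊂ C := ⟨fun x hx => (h1 hx).1, fun h => (h1 (h hcC)).2 hcK'⟩
    have h3 := Set.ncard_lt_ncard h2 (Set.toFinite _)
    exact absurd (hmin K' hK' v' hv' d hd x' y' s' hs' hsK' hsC') (not_le.2 h3)
  have hCC' : ∀ x ∈ C', x ∉ C := by
    intro x hx hxC
    have hside : G.IsSide K' (C \ K') := ⟨fun x hx => hx.2, fun x hx y hxy hy =>
      ⟨hCS x hx.1 y hxy fun h => hy (hSK'' y h), hy⟩⟩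
    exact hside.notMem_of_mem_compOf (fun h => hdC h.1) hx ⟨hxC, hCK'.notMem x hx⟩
  have hSC' : ∀ x ∈ C', x ∉ S := fun x hx hxS => hCK'.notMem x hx (hSK'' x hxS)
  have hs'C : ∀ w ∈ s', w ∉ C := by
    intro w hw hwC
    have hwv : ∀ z ∈ s', z ∈ C → z = v' := fun z hz hzC =>
      hsK' z hz ((hsC' z hz).resolve_right fun h => hCC' z h hzC)
    have hs'S : ∀ z ∈ s', z ∉ S := by
      intro z hz hzS
      have h1 : z = w := (hsK' z hz (hSK'' z hzS)).trans (hwv w hw hwC).symm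
      exact hSC w hwC (h1 ▸ hzS)
    rcases hCside.dichotomy hs' (fun z hz hzS => absurd hzS (hs'S z hz)) with h | h
    · exact hs'.notMem_of_subsingleton hL
        (fun z hz => hwv z hz ((h z hz).resolve_left (hs'S z hz))) hs'.start_mem
    · exact h w hw hwC
  have hvS : v ∈ S := by
    by_contra hvS
    have hsS : ∀ z ∈ s, z ∉ S := fun z hz hzS => hvS (hsK z hz hzS.1 ▸ hzS)
    have hvC : v ∉ C := fun h => hCK.notMem v h hv
    obtain ⟨w, hw, hw'⟩ := hconn.exists_mem_of_longest hmax hs hs'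
    have hwv : w = v := hsK w hw ((hsC w hw).resolve_right (hs'C w hw'))
    rcases hCside.dichotomy hs (fun z hz hzS => absurd hzS (hsS z hz)) with h | h
    · exact (h w hw).elim (hsS w hw) (hs'C w hw')
    · exact hs.notMem_of_subsingleton hL
        (fun z hz => hsK z hz ((hsC z hz).resolve_right (h z hz))) hs.start_mem
  obtain ⟨w, hw, hw'⟩ := hconn.exists_mem_of_longest hmax hs hs'
  have hwv : w = v := hsK w hw ((hsC w hw).resolve_right (hs'C w hw'))
  subst hwv
  have hwv' : w = v' := hsK' w hw' (hSK'' w hvS)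
  subst hwv'
  obtain ⟨u, hu, e, f, r, hr, hwr, hru⟩ : ∃ u ∈ S, ∃ e f r, G.PathOn e f r L ∧ w ∉ r ∧
      ∀ z ∈ r, z ∈ S → z = u := by
    by_cases hu : ∃ u ∈ S, u ≠ w
    · obtain ⟨u, hu, huw⟩ := hu
      obtain ⟨e, f, r, hr, hrS⟩ := havoid (S \ {u}) (by
        rw [Set.ncard_sdiff_singleton_of_mem hu]
        omega)
      refine ⟨u, hu, e, f, r, hr, hrS w ⟨hvS, huw.symm⟩, fun z hz hzS => ?_⟩
      by_contra hne
      exact hrS z ⟨hzS, hne⟩ hz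
    · push Not at hu
      obtain ⟨e, f, r, hr, hwr⟩ := hone w
      exact ⟨w, hvS, e, f, r, hr, hwr, fun z _ hzS => hu z hzS⟩
  refine false_of_two_sides hconn hmax hScl hCside hvS hs hs' hw hw' ?_ ?_ hr hwr hu hru
  · exact fun z hz => (hsC z hz).imp_left (hsK z hz)
  · intro z hz
    rcases hsC' z hz with h | h
    · exact .inl (hsK' z hz h)
    · exact .inr ⟨hSC' z h, hCC' z h⟩

end SimpleGraph

theorem mainTheorem1 {V : Type*} [Finite V] (G : SimpleGraph V)
    (hconn : G.Connected) (hchordal : G.IsChordal) :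
    G.lpt ≤ max 1 (G.cliqueNum - 2) := by
  have := hconn.nonempty
  obtain ⟨u, v, p, hp, hmax⟩ := SimpleGraph.Walk.exists_isPath_forall_isPath_length_le_length G
  by_contra! hlt
  refine SimpleGraph.false_of_longest_avoid hconn hchordal (L := p.length) ?_ ?_
  · rintro a b s n ⟨q, hq, -, rfl⟩
    exact hmax _ _ q hq
  · intro S hS
    have hnot : ¬ G.IsLongestPathTransversal S.toFinite.toFinset := by
      intro h
      have h1 : G.lpt ≤ S.toFinite.toFinset.card := Nat.sInf_le ⟨_, h, rfl⟩
      rw [← Set.ncard_eq_toFinset_card S] at h1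
      omega
    rw [SimpleGraph.IsLongestPathTransversal] at hnot
    push Not at hnot
    obtain ⟨a, b, q, hq, hqS⟩ := hnot
    refine ⟨a, b, {w | w ∈ q.support}, ⟨q, hq.1, by simp, ?_⟩, fun w hw => hqS w (by simpa)⟩
    exact le_antisymm (hmax _ _ q hq.1) (hq.2 p hp)
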